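/- **Definitions.** A permutation $\pi$ of $\{1,\dots,m\}$ is a *pattern* of a permutation $\sigma$ of $\{1,\dots,k\}$ if there are $i_1<\dots<i_m$ in $\{1,\dots,k\}$ such that $\sigma_{i_\ell}<\sigma_{i_{\ell'}}$ whenever $\pi_\ell<\pi_{\ell'}$. The empty pattern $\epsilon$ has size $0$. A *longest common pattern* of $\sigma$ and $\tau$ is a permutation of maximal size among those that are patterns of both. A *common interval* of $\sigma$ is a nonempty set of consecutive entries whose values form an interval of integers; it is *strong* if it overlaps no other common interval (two sets overlap if they meet and neither contains the other). A permutation of size $d$ is *simple* if its only common intervals are the singletons and the whole permutation. The strong intervals of $\sigma$, ordered by inclusion, form an ordered tree whose root is $\sigma$ and whose leaves are the entries of $\sigma$; the children of a node are the maximal strong intervals properly contained in it, ordered from left to right. An internal node is *linear* if every union of consecutive children is a common interval; it is labeled $+$ or $-$ according to whether the values in its children increase or decrease from left to right. Every other internal node, with children $V_1,\dots,V_d$, is *prime*: $d\ge 3$ and no union of at least two consecutive children, other than the union of all of them, is a common interval. It is labeled by the simple permutation $\rho$ of size $d$ such that $\rho_p<\rho_q$ if and only if the values in $V_p$ are smaller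 than those in $V_q$. The *expanded decomposition tree* $T_\sigma$ is obtained from this labeled tree by forgetting the intervals and replacing each linear node with children $V_1,\dots,V_r$ by the left comb $(\dots((V_1,V_2),V_3),\dots,V_r)$ of $r-1$ binary nodes with the same sign, called positive nodes for $+$ and negative nodes for $-$. For patterns $\pi^1,\dots,\pi^d$ of sizes $k_1,\dots,k_d$ and a permutation $\rho$ of size $d$, the *$\rho$-concatenation* $\odot_\rho(\pi^1,\dots,\pi^d)$ is the concatenation of the words $\mathrm{shift}(\pi^1,\rho_1),\dots,\mathrm{shift}(\pi^d,\rho_d)$, where $\mathrm{shift}(\pi^p,\rho_p)$ is obtained from $\pi^p$ by adding $k_{\rho^{-1}(1)}+\dots+k_{\rho^{-1}(\rho_p-1)}$ to each entry. Put $\pi\oplus\pi'=\odot_{12}(\pi,\pi')$ and $\pi\ominus\pi'=\odot_{21}(\pi,\pi')$. For a nonempty finite set $S$ of patterns, $\mathrm{Longest}(S)$ is an element of $S$ of maximal length (for any fixed choice rule). **Algorithm.** Input: the expanded decomposition tree $T_\sigma$ of a permutation $\sigma$, and a permutation $\tau$ of size $n$. 1. Initialize all cells $M(V,i,j,a,b)$,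 for $V$ a node of $T_\sigma$, to $\epsilon$. (Cells with an empty index interval, $i>j$, or an empty value interval, $a>b$, stay equal to $\epsilon$.) 2. For each leaf $V$ and all $1\le i\le j\le n$, $1\le a\le b\le n$: if there is $h\in\{i,\dots,j\}$ with $a\le\tau_h\le b$, set $M(V,i,j,a,b)\leftarrow 1$. 3. For each internal node $V$ in postfix order and all $1\le i\le j\le n$, $1\le a\le b\le n$, set $M(V,i,j,a,b)\leftarrow\mathrm{Longest}(S)$, where - if $V$ is positive with children $V_L,V_R$, $S=\{M(V_L,i,h-1,a,c-1)\oplus M(V_R,h,j,c,b): i\le h\le j+1,\ a\le c\le b+1\}$; - if $V$ is negative with children $V_L,V_R$, $S=\{M(V_L,i,h-1,c,b)\ominus M(V_R,h,j,a,c-1): i\le h\le j+1,\ a\le c\le b+1\}$; - if $V$ is prime with label $\rho$ and children $V_1,\dots,V_d$, $S$ is the set of all $\odot_\rho\big((M(V_p,h_{p-1},h_p-1,c_{\rho_p-1},c_{\rho_p}-1))_{1\le p\le d}\big)$ with $i=h_0\le h_1\le\dots\le h_d=j+1$ and $a=c_0\le c_1\le\dots\le c_d=b+1$. 4. Output $M(\text{root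 of }T_\sigma,1,n,1,n)$. **Proposition.** The algorithm is correct: for every permutation $\sigma$ with expanded decomposition tree $T_\sigma$ and every permutation $\tau$, its output on $T_\sigma$ and $\tau$ is a longest common pattern of $\sigma$ and $\tau$. -/

import Mathlib

namespace LCP

/-! ### Permutations and patterns

A permutation of size `k` is a `σ : Equiv.Perm (Fin k)`; its usual (1-based) one-line notation is
the word `word σ`. -/

/-- The word `σ₁ σ₂ … σ_k` of a permutation, with values in `{1, …, k}`. -/
def word {k : ℕ} (σ : Equiv.Perm (Fin k)) : List ℕ :=
  List.ofFn fun x => (σ x : ℕ) + 1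

/-- `π` is a pattern of `σ`. -/
def IsPattern {m k : ℕ} (π : Equiv.Perm (Fin m)) (σ : Equiv.Perm (Fin k)) : Prop :=
  ∃ f : Fin m → Fin k, StrictMono f ∧ ∀ x y, π x < π y → σ (f x) < σ (f y)

/-- The word `w` is (the word of) a common pattern of `σ` and `τ`, of maximal size among all
common patterns of `σ` and `τ`. -/
def IsLongestCommonPattern (w : List ℕ) {k n : ℕ}
    (σ : Equiv.Perm (Fin k)) (τ : Equiv.Perm (Fin n)) : Prop :=
  ∃ (m : ℕ) (π : Equiv.Perm (Fin m)), w = word π ∧ IsPattern π σ ∧ IsPattern π τ ∧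
    ∀ (m' : ℕ) (π' : Equiv.Perm (Fin m')), IsPattern π' σ → IsPattern π' τ → m' ≤ m

/-! ### Common intervals and strong intervals

A subsequence of consecutive entries of `σ` is given by its set of positions. -/

/-- A nonempty set of consecutive positions whose set of values is again an interval. -/
def IsCommonInterval {k : ℕ} (σ : Equiv.Perm (Fin k)) (I : Set (Fin k)) : Prop :=
  I.Nonempty ∧ I.OrdConnected ∧ (σ '' I).OrdConnected

def Overlap {α : Type*} (I J : Set α) : Prop :=
  (I \ J).Nonempty ∧ (J \ I).Nonempty ∧ (I ∩ J).Nonempty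

/-- A common interval that overlaps no common interval. -/
def IsStrongInterval {k : ℕ} (σ : Equiv.Perm (Fin k)) (I : Set (Fin k)) : Prop :=
  IsCommonInterval σ I ∧ ∀ J, IsCommonInterval σ J → ¬ Overlap I J

/-- A simple permutation: the only common intervals are the singletons and the whole. -/
def IsSimple {d : ℕ} (ρ : Equiv.Perm (Fin d)) : Prop :=
  ∀ I, IsCommonInterval ρ I → (∃ x, I = {x}) ∨ I = Set.univ

/-- `J 0, …, J (d-1)` are, from left to right, the children of the strong interval `I` in the tree
of strong intervals ordered by inclusion, that is, the maximal strong intervals properly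
contained in `I`. -/
def AreChildren {k d : ℕ} (σ : Equiv.Perm (Fin k)) (I : Set (Fin k))
    (J : Fin d → Set (Fin k)) : Prop :=
  (∀ p q, p < q → ∀ x ∈ J p, ∀ y ∈ J q, x < y) ∧
  ∀ K, (∃ p, J p = K) ↔ Maximal (fun K' => IsStrongInterval σ K' ∧ K' ⊂ I) K

/-- The union of the consecutive children `J p, …, J q`. -/
def consecutiveUnion {k d : ℕ} (J : Fin d → Set (Fin k)) (p q : Fin d) : Set (Fin k) :=
  {x | ∃ r, p ≤ r ∧ r ≤ q ∧ x ∈ J r}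

/-- All values at the positions in `I` are smaller than all values at the positions in `J`. -/
def ValuesBelow {k : ℕ} (σ : Equiv.Perm (Fin k)) (I J : Set (Fin k)) : Prop :=
  ∀ x ∈ I, ∀ y ∈ J, σ x < σ y

/-! ### Labeled and expanded decomposition trees -/

inductive Sign
  | plus
  | minus

/-- Ordered trees whose internal nodes are linear nodes (with a sign and at least two children) or
prime nodes (labeled by a permutation of size the number of children). -/
inductive LabeledTree
  | leaf : LabeledTree
  | linear (s : Sign) (m : ℕ) (c : Fin (m + 2) → LabeledTree) : LabeledTree
  | prime (d : ℕ) (ρ : Equiv.Perm (Fin d)) (c : Fin d → LabeledTree) : LabeledTree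

/-- The labeled tree represents the part of the labeled decomposition tree of `σ` that lies
below the strong interval `I`. -/
def LabeledTree.Represents {k : ℕ} (σ : Equiv.Perm (Fin k)) :
    LabeledTree → Set (Fin k) → Prop
  | .leaf, I => ∃ x, I = {x}
  | .linear s m c, I => ∃ J : Fin (m + 2) → Set (Fin k),
      AreChildren σ I J ∧
      (∀ p q, p ≤ q → IsCommonInterval σ (consecutiveUnion J p q)) ∧
      (∀ p q, p < q → match s with
        | .plus => ValuesBelow σ (J p) (J q)
        | .minus => ValuesBelow σ (J q) (J p)) ∧
      ∀ p, (c p).Represents σ (J p)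
  | .prime d ρ c, I => ∃ J : Fin d → Set (Fin k),
      AreChildren σ I J ∧
      3 ≤ d ∧
      (∀ p q, p < q → IsCommonInterval σ (consecutiveUnion J p q) →
        (p : ℕ) = 0 ∧ (q : ℕ) + 1 = d) ∧
      IsSimple ρ ∧
      (∀ p q, ρ p < ρ q ↔ ValuesBelow σ (J p) (J q)) ∧
      ∀ p, (c p).Represents σ (J p)

/-- `L` is the labeled decomposition tree of `σ`. -/
def IsLabeledDecompositionTree {k : ℕ} (L : LabeledTree) (σ : Equiv.Perm (Fin k)) : Prop :=
  L.Represents σ Set.univ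

/-- Ordered trees with binary positive and negative nodes, and prime nodes. -/
inductive DTree
  | leaf : DTree
  | pos (l r : DTree) : DTree
  | neg (l r : DTree) : DTree
  | prime (d : ℕ) (ρ : Equiv.Perm (Fin d)) (c : Fin d → DTree) : DTree

/-- The left comb `(…((V₁, V₂), V₃), …, V_{m+1})` of binary nodes of sign `s`. -/
def leftComb (s : Sign) : (m : ℕ) → (Fin (m + 1) → DTree) → DTree
  | 0, c => c 0
  | m + 1, c =>
    match s with
    | .plus => .pos (leftComb s m fun p => c p.castSucc) (c (Fin.last (m + 1)))
    | .minus => .neg (leftComb s m fun p => c p.castSucc) (c (Fin.last (m + 1)))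

/-- Replace each linear node of a labeled tree by a left comb of binary nodes of the same sign. -/
def LabeledTree.expand : LabeledTree → DTree
  | .leaf => .leaf
  | .linear s m c => leftComb s (m + 1) fun p => (c p).expand
  | .prime d ρ c => .prime d ρ fun p => (c p).expand

/-- `T` is the expanded decomposition tree of `σ`. -/
def IsExpandedDecompositionTree {k : ℕ} (T : DTree) (σ : Equiv.Perm (Fin k)) : Prop :=
  ∃ L : LabeledTree, IsLabeledDecompositionTree L σ ∧ T = L.expand

/-! ### Concatenation of patterns -/

/-- The positive concatenation `π ⊕ π'`. -/
def oplus (π π' : List ℕ) : List ℕ := π ++ π'.map (· + π.length)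

/-- The negative concatenation `π ⊖ π'`. -/
def ominus (π π' : List ℕ) : List ℕ := π.map (· + π'.length) ++ π'

/-- The `ρ`-concatenation: the `p`-th block is shifted by the total length of the blocks `q` with
`ρ q < ρ p`, that is, by the sum of the lengths of the blocks `ρ⁻¹ v` over `v < ρ p`. -/
def rhoConcat {d : ℕ} (ρ : Equiv.Perm (Fin d)) (π : Fin d → List ℕ) : List ℕ :=
  (List.ofFn fun p =>
    (π p).map (· + ∑ v ∈ Finset.univ.filter (· < ρ p), (π (ρ.symm v)).length)).flatten

/-! ### The dynamic programming algorithm -/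

/-- A rule that returns from each nonempty finite set of words an element of maximal length. -/
def IsLongestRule (longest : Finset (List ℕ) → List ℕ) : Prop :=
  ∀ S : Finset (List ℕ), S.Nonempty → longest S ∈ S ∧ ∀ w ∈ S, w.length ≤ (longest S).length

/-- Contents of the array `M(V, i, j, a, b)`. A node `V` is given by its address, the list of
child indices read from the node up to the root, so that `[]` is the root and `p :: V` is the
`p`-th child (counted from 0) of `V`. -/
abbrev Table := List ℕ → ℕ → ℕ → ℕ → ℕ → List ℕ

/-- The nodes of the tree rooted at address `V`, in postfix order, each with its subtree. -/
def DTree.postfixNodes : DTree → List ℕ → List (List ℕ × DTree)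
  | .leaf, V => [(V, .leaf)]
  | .pos l r, V => l.postfixNodes (0 :: V) ++ r.postfixNodes (1 :: V) ++ [(V, .pos l r)]
  | .neg l r, V => l.postfixNodes (0 :: V) ++ r.postfixNodes (1 :: V) ++ [(V, .neg l r)]
  | .prime d ρ c, V =>
      ((List.finRange d).flatMap fun p => (c p).postfixNodes ((p : ℕ) :: V)) ++ [(V, .prime d ρ c)]

/-- For all `1 ≤ i ≤ j ≤ n` and `1 ≤ a ≤ b ≤ n`, put `f i j a b` in the cell `(V, i, j, a, b)`. -/
def assign (n : ℕ) (M : Table) (V : List ℕ) (f : ℕ → ℕ → ℕ → ℕ → List ℕ) : Table :=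
  fun W i j a b =>
    if W = V ∧ (1 ≤ i ∧ i ≤ j ∧ j ≤ n) ∧ (1 ≤ a ∧ a ≤ b ∧ b ≤ n) then f i j a b
    else M W i j a b

/-- All sequences `lo = h₀ ≤ h₁ ≤ … ≤ h_d = hi`. -/
def slicings (d lo hi : ℕ) : Finset (Fin (d + 1) → ℕ) :=
  (Fintype.piFinset fun _ : Fin (d + 1) => Finset.Icc lo hi).filter fun h =>
    h 0 = lo ∧ h (Fin.last d) = hi ∧ ∀ p : Fin d, h p.castSucc ≤ h p.succ

/-- Processing of a node in the phase that fills in the leaves: a leaf gets the pattern `1` in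
each cell for which some position `h ∈ {i, …, j}` has `a ≤ τ_h ≤ b`; positions and values are
1-based. -/
def fillLeaf {n : ℕ} (τ : Equiv.Perm (Fin n)) (M : Table) : List ℕ × DTree → Table
  | (V, .leaf) => assign n M V fun i j a b =>
      if ∃ h : Fin n, i ≤ (h : ℕ) + 1 ∧ (h : ℕ) + 1 ≤ j ∧ a ≤ (τ h : ℕ) + 1 ∧ (τ h : ℕ) + 1 ≤ b
      then [1] else M V i j a b
  | _ => M

/-- Processing of a node in the phase that fills in the internal nodes. All subtracted indices are
at least 1. -/
def fillInternal (n : ℕ) (longest : Finset (List ℕ) → List ℕ) (M : Table) :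
    List ℕ × DTree → Table
  | (_, .leaf) => M
  | (V, .pos _ _) => assign n M V fun i j a b =>
      longest ((Finset.Icc i (j + 1) ×ˢ Finset.Icc a (b + 1)).image fun hc =>
        oplus (M (0 :: V) i (hc.1 - 1) a (hc.2 - 1)) (M (1 :: V) hc.1 j hc.2 b))
  | (V, .neg _ _) => assign n M V fun i j a b =>
      longest ((Finset.Icc i (j + 1) ×ˢ Finset.Icc a (b + 1)).image fun hc =>
        ominus (M (0 :: V) i (hc.1 - 1) hc.2 b) (M (1 :: V) hc.1 j a (hc.2 - 1)))
  | (V, .prime d ρ _) => assign n M V fun i j a b =>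
      longest ((slicings d i (j + 1) ×ˢ slicings d a (b + 1)).image fun hc =>
        rhoConcat ρ fun p =>
          M ((p : ℕ) :: V) (hc.1 p.castSucc) (hc.1 p.succ - 1)
            (hc.2 (ρ p).castSucc) (hc.2 (ρ p).succ - 1))

/-- The output of the algorithm on the tree `T` and the permutation `τ`: initialize all cells with
the empty pattern, fill in the leaves, fill in the internal nodes in postfix order, and return
the cell `M(root, 1, n, 1, n)`. -/
def algorithm (longest : Finset (List ℕ) → List ℕ) (T : DTree) {n : ℕ}
    (τ : Equiv.Perm (Fin n)) : List ℕ :=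
  let M₀ : Table := fun _ _ _ _ _ => []
  let M₁ := (T.postfixNodes []).foldl (fillLeaf τ) M₀
  let M₂ := (T.postfixNodes []).foldl (fillInternal n longest) M₁
  M₂ [] 1 n 1 n

end LCP

/-! The tree presents `σ` as an iterated inflation: at each internal node the positions split into
blocks lying one after another, whose values are separated in the order given by the label (12 or 21
at a binary node). Fix a common pattern of such a node and a box of positions and values of `τ`. Its
occurrence in `τ` respects positions and values, so the points of `τ` used by different blocks are
separated in both directions. One slicing of the positions and one of the values therefore put the
share of every block into its own sub-box, and the size is at most the sum of the children's optima
there (`exists_card_le_length_sliceConcat`). Conversely, concatenating common patterns found in the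
sub-boxes gives a common pattern (`commonIn_sliceConcat`). Hence the longest concatenation is
optimal (`optimal_longest`).

The two bounds use different objects. `CommonIn` records values, since the output must be the word
of a permutation; `Matching` records only pairs of positions, so that it restricts to a block
without renumbering.

The rest shows that the folds carry out this recursion: unused cells stay empty, and nodes in the
subtrees of different children have different addresses (`Decomposes.computes`). -/

namespace LCP

/-! ### The inflation structure carried by a decomposition tree -/

/-- Every element of `A` lies to the left of every element of `B`. -/
def Before {k : ℕ} (A B : Set (Fin k)) : Prop := ∀ x ∈ A, ∀ y ∈ B, x < y

/-- The tree `T` describes the entries of `σ` at the positions in `I` as iterated inflations. -/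
inductive Decomposes {k : ℕ} (σ : Equiv.Perm (Fin k)) : DTree → Set (Fin k) → Prop
  | leaf (x : Fin k) : Decomposes σ .leaf {x}
  | pos {l r : DTree} {A B : Set (Fin k)} (hl : Decomposes σ l A) (hr : Decomposes σ r B)
      (hAB : Before A B) (hv : ValuesBelow σ A B) : Decomposes σ (.pos l r) (A ∪ B)
  | neg {l r : DTree} {A B : Set (Fin k)} (hl : Decomposes σ l A) (hr : Decomposes σ r B)
      (hAB : Before A B) (hv : ValuesBelow σ B A) : Decomposes σ (.neg l r) (A ∪ B)
  | prime {d : ℕ} {ρ : Equiv.Perm (Fin d)} {c : Fin d → DTree} {J : Fin d → Set (Fin k)}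
      (hd : 0 < d) (hc : ∀ p, Decomposes σ (c p) (J p)) (hJ : ∀ p q, p < q → Before (J p) (J q))
      (hv : ∀ p q, ρ p < ρ q → ValuesBelow σ (J p) (J q)) :
      Decomposes σ (.prime d ρ c) (⋃ p, J p)

theorem isStrongInterval_singleton {k : ℕ} (σ : Equiv.Perm (Fin k)) (x : Fin k) :
    IsStrongInterval σ {x} := by
  refine ⟨⟨Set.singleton_nonempty x, Set.ordConnected_singleton, ?_⟩, ?_⟩
  · rw [Set.image_singleton]
    exact Set.ordConnected_singleton
  · rintro J - ⟨⟨y, rfl, hy⟩, -, ⟨z, rfl, hz⟩⟩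
    exact hy hz

/-- Singletons are strong, and two children supply two distinct points of `I`, so each singleton in
`I` is proper. By finiteness it lies in a maximal proper strong interval, which is a child. -/
theorem AreChildren.iUnion_eq {k d : ℕ} {σ : Equiv.Perm (Fin k)} {I : Set (Fin k)}
    {J : Fin d → Set (Fin k)} (h : AreChildren σ I J) (hd : 2 ≤ d) : ⋃ p, J p = I := by
  have hmax : ∀ p, Maximal (fun K' => IsStrongInterval σ K' ∧ K' ⊂ I) (J p) :=
    fun p => (h.2 _).1 ⟨p, rfl⟩
  have hsub : ∀ p, J p ⊆ I := fun p => (hmax p).prop.2.subset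
  obtain ⟨x, hx⟩ := (hmax ⟨0, by omega⟩).prop.1.1.1
  obtain ⟨y, hy⟩ := (hmax ⟨1, by omega⟩).prop.1.1.1
  have hxy : x < y := h.1 ⟨0, by omega⟩ ⟨1, by omega⟩ (by simp [Fin.lt_def]) x hx y hy
  refine Set.Subset.antisymm (Set.iUnion_subset hsub) fun z hz => ?_
  have hz' : ({z} : Set (Fin k)) ⊂ I := by
    refine ⟨Set.singleton_subset_iff.2 hz, fun hI => ?_⟩
    have h1 : x = z := hI (hsub _ hx)
    have h2 : y = z := hI (hsub _ hy)
    exact hxy.ne (h1.trans h2.symm)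
  obtain ⟨K, hzK, hK⟩ := (Set.toFinite {K' | IsStrongInterval σ K' ∧ K' ⊂ I}).exists_le_maximal
    (a := {z}) ⟨isStrongInterval_singleton σ z, hz'⟩
  obtain ⟨p, rfl⟩ := (h.2 K).2 hK
  exact Set.mem_iUnion.2 ⟨p, hzK rfl⟩

/-- The root of the comb splits off the last child, which is separated from the union of the others
because it is separated from each of them. -/
theorem decomposes_leftComb {k : ℕ} {σ : Equiv.Perm (Fin k)} (s : Sign) (m : ℕ)
    (c : Fin (m + 1) → DTree) (J : Fin (m + 1) → Set (Fin k))
    (hc : ∀ p, Decomposes σ (c p) (J p)) (hJ : ∀ p q, p < q → Before (J p) (J q))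
    (hplus : s = .plus → ∀ p q, p < q → ValuesBelow σ (J p) (J q))
    (hminus : s = .minus → ∀ p q, p < q → ValuesBelow σ (J q) (J p)) :
    Decomposes σ (leftComb s m c) (⋃ p, J p) := by
  induction m with
  | zero =>
    have : ⋃ p, J p = J 0 := by
      ext x
      simp [Fin.exists_fin_one]
    rw [this]
    exact hc 0
  | succ m ih =>
    have hU : ⋃ p, J p = (⋃ p : Fin (m + 1), J p.castSucc) ∪ J (Fin.last (m + 1)) := by
      ext x
      simp [Fin.exists_fin_succ']
    have hl := ih (fun p => c p.castSucc) (fun p => J p.castSucc) (fun p => hc _)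
      (fun p q hpq => hJ _ _ (Fin.castSucc_lt_castSucc_iff.2 hpq))
      (fun hs p q hpq => hplus hs _ _ (Fin.castSucc_lt_castSucc_iff.2 hpq))
      (fun hs p q hpq => hminus hs _ _ (Fin.castSucc_lt_castSucc_iff.2 hpq))
    have hB : Before (⋃ p : Fin (m + 1), J p.castSucc) (J (Fin.last (m + 1))) := by
      intro x hx y hy
      obtain ⟨p, hp⟩ := Set.mem_iUnion.1 hx
      exact hJ _ _ (Fin.castSucc_lt_last p) x hp y hy
    rw [hU]
    cases s with
    | plus =>
      refine .pos hl (hc _) hB fun x hx y hy => ?_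
      obtain ⟨p, hp⟩ := Set.mem_iUnion.1 hx
      exact hplus rfl _ _ (Fin.castSucc_lt_last p) x hp y hy
    | minus =>
      refine .neg hl (hc _) hB fun y hy x hx => ?_
      obtain ⟨p, hp⟩ := Set.mem_iUnion.1 hx
      exact hminus rfl _ _ (Fin.castSucc_lt_last p) y hy x hp

theorem LabeledTree.Represents.decomposes {k : ℕ} {σ : Equiv.Perm (Fin k)} (L : LabeledTree)
    (I : Set (Fin k)) (h : L.Represents σ I) : Decomposes σ L.expand I := by
  induction L generalizing I with
  | leaf =>
    obtain ⟨x, rfl⟩ := h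
    exact .leaf x
  | linear s m c ih =>
    obtain ⟨J, hJ, -, hv, hc⟩ := h
    rw [← hJ.iUnion_eq (by omega)]
    exact decomposes_leftComb s (m + 1) _ J (fun p => ih p _ (hc p)) hJ.1
      (fun hs => by subst hs; exact hv) (fun hs => by subst hs; exact hv)
  | prime d ρ c ih =>
    obtain ⟨J, hJ, hd, -, -, hv, hc⟩ := h
    rw [← hJ.iUnion_eq (by omega)]
    exact .prime (by omega) (fun p => ih p _ (hc p)) hJ.1 fun p q => (hv p q).1

/-! ### Common patterns inside given sets of positions -/

/-- The positions `h` of `τ` with `i ≤ h ≤ j` and `a ≤ τ_h ≤ b` (in 1-based notation). -/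
def box {n : ℕ} (τ : Equiv.Perm (Fin n)) (i j a b : ℕ) : Set (Fin n) :=
  {h | i ≤ (h : ℕ) + 1 ∧ (h : ℕ) + 1 ≤ j ∧ a ≤ (τ h : ℕ) + 1 ∧ (τ h : ℕ) + 1 ≤ b}

section Common

variable {k n : ℕ} (σ : Equiv.Perm (Fin k)) (τ : Equiv.Perm (Fin n))

/-- Compatibility of two entries, listed from left to right, of a common pattern; an entry
consists of its value, its position in `σ` and its position in `τ`. -/
def EntryRel (x y : ℕ × Fin k × Fin n) : Prop :=
  x.2.1 < y.2.1 ∧ x.2.2 < y.2.2 ∧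
    ((x.1 < y.1 ∧ σ x.2.1 < σ y.2.1 ∧ τ x.2.2 < τ y.2.2) ∨
      (y.1 < x.1 ∧ σ y.2.1 < σ x.2.1 ∧ τ y.2.2 < τ x.2.2))

/-- `w` is the word of a permutation that occurs in `σ` at positions in `I` and in `τ` at
positions in `B`. -/
def CommonIn (I : Set (Fin k)) (B : Set (Fin n)) (w : List ℕ) : Prop :=
  ∃ L : List (ℕ × Fin k × Fin n), L.map Prod.fst = w ∧ L.Pairwise (EntryRel σ τ) ∧
    ∀ x ∈ L, 1 ≤ x.1 ∧ x.1 ≤ L.length ∧ x.2.1 ∈ I ∧ x.2.2 ∈ B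

/-- The pairs in `Q` match positions in `I` and in `B` respecting positions and values. -/
def Matching (I : Set (Fin k)) (B : Set (Fin n)) (Q : Finset (Fin k × Fin n)) : Prop :=
  (∀ e ∈ Q, e.1 ∈ I ∧ e.2 ∈ B) ∧
  ∀ e ∈ Q, ∀ f ∈ Q, (e.1 = f.1 → e = f) ∧ (e.1 < f.1 → e.2 < f.2) ∧
    (σ e.1 < σ f.1 → τ e.2 < τ f.2)

/-- `w` is a longest common pattern of the restrictions of `σ` to `I` and of `τ` to `B`. -/
def Optimal (I : Set (Fin k)) (B : Set (Fin n)) (w : List ℕ) : Prop :=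
  CommonIn σ τ I B w ∧ ∀ Q, Matching σ τ I B Q → Q.card ≤ w.length

variable {σ τ}

/-- `EntryRel` makes the values distinct, and they lie between 1 and the length, so by finiteness
they form a permutation. -/
theorem CommonIn.exists_perm {I : Set (Fin k)} {B : Set (Fin n)} {w : List ℕ}
    (h : CommonIn σ τ I B w) :
    ∃ π : Equiv.Perm (Fin w.length), w = word π ∧ IsPattern π σ ∧ IsPattern π τ := by
  obtain ⟨L, rfl, hL, hb⟩ := h
  have hlen : (L.map Prod.fst).length = L.length := List.length_map _
  rw [hlen]
  have hp : ∀ x y : Fin L.length, x < y → EntryRel σ τ L[x] L[y] :=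
    fun x y hxy => List.pairwise_iff_getElem.1 hL _ _ x.2 y.2 hxy
  have hm : ∀ x : Fin L.length, 1 ≤ L[x].1 ∧ L[x].1 ≤ L.length :=
    fun x => ⟨(hb _ (List.getElem_mem x.2)).1, (hb _ (List.getElem_mem x.2)).2.1⟩
  let φ : Fin L.length → Fin L.length := fun x => ⟨L[x].1 - 1, by have := hm x; omega⟩
  have hφ : ∀ x y, φ x < φ y ↔ L[x].1 < L[y].1 := by
    intro x y
    have := hm x
    have := hm y
    change L[x].1 - 1 < L[y].1 - 1 ↔ _
    omega
  have hinj : Function.Injective φ := by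
    intro x y hxy
    have h1 : ¬ L[x].1 < L[y].1 := by rw [← hφ, hxy]; exact lt_irrefl _
    have h2 : ¬ L[y].1 < L[x].1 := by rw [← hφ, hxy]; exact lt_irrefl _
    rcases lt_trichotomy x y with h | h | h
    · rcases (hp x y h).2.2 with h' | h'
      · exact absurd h'.1 h1
      · exact absurd h'.1 h2
    · exact h
    · rcases (hp y x h).2.2 with h' | h'
      · exact absurd h'.1 h2
      · exact absurd h'.1 h1
  have hval : ∀ x y, φ x < φ y → σ L[x].2.1 < σ L[y].2.1 ∧ τ L[x].2.2 < τ L[y].2.2 := by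
    intro x y hxy
    have hxy' := (hφ x y).1 hxy
    rcases lt_trichotomy x y with h | h | h
    · rcases (hp x y h).2.2 with h' | h'
      · exact h'.2
      · exact absurd hxy' h'.1.not_gt
    · subst h
      exact absurd hxy (lt_irrefl _)
    · rcases (hp y x h).2.2 with h' | h'
      · exact absurd hxy' h'.1.not_gt
      · exact h'.2
  refine ⟨Equiv.ofBijective φ (Finite.injective_iff_bijective.1 hinj), ?_,
    ⟨fun x => L[x].2.1, fun x y hxy => (hp x y hxy).1, fun x y hxy => (hval x y hxy).1⟩,
    ⟨fun x => L[x].2.2, fun x y hxy => (hp x y hxy).2.1, fun x y hxy => (hval x y hxy).2⟩⟩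
  refine List.ext_getElem (by simp [word]) fun x h1 h2 => ?_
  have := hm ⟨x, by simpa using h1⟩
  simp only [word, List.getElem_map, List.getElem_ofFn, Equiv.ofBijective_apply, φ]
  simp only [Fin.getElem_fin] at this ⊢
  omega

/-- Any competing pattern, embedded by `f` and `g`, yields the matching of all pairs `(f x, g x)`,
whose cardinality is the size of the pattern. -/
theorem Optimal.isLongestCommonPattern {w : List ℕ} (h : Optimal σ τ Set.univ Set.univ w) :
    IsLongestCommonPattern w σ τ := by
  obtain ⟨π, hw, hσ, hτ⟩ := h.1.exists_perm
  refine ⟨_, π, hw, hσ, hτ, fun m' π' hσ' hτ' => ?_⟩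
  obtain ⟨f, hf, hfσ⟩ := hσ'
  obtain ⟨g, hg, hgτ⟩ := hτ'
  have hQ := h.2 (Finset.univ.image fun x => (f x, g x)) ⟨by simp, ?_⟩
  · rwa [Finset.card_image_of_injective _ fun x y hxy => hf.injective (Prod.ext_iff.1 hxy).1,
      Finset.card_univ, Fintype.card_fin] at hQ
  · simp only [Finset.mem_image, Finset.mem_univ, true_and, forall_exists_index,
      forall_apply_eq_imp_iff]
    refine fun x y => ⟨fun e => by rw [hf.injective e], fun e => hg (hf.lt_iff_lt.1 e),
      fun e => hgτ _ _ ?_⟩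
    -- The embedding into `σ` also reflects the order of values, since the order of `π'` is total.
    rcases lt_trichotomy (π' x) (π' y) with h' | h' | h'
    · exact h'
    · rw [π'.injective h'] at e
      exact absurd e (lt_irrefl _)
    · exact absurd e (hfσ _ _ h').not_gt

theorem optimal_nil {I : Set (Fin k)} {B : Set (Fin n)} (hB : B = ∅) : Optimal σ τ I B [] := by
  subst hB
  refine ⟨⟨[], rfl, .nil, by simp⟩, fun Q hQ => ?_⟩
  rw [List.length_nil, Nat.le_zero, Finset.card_eq_zero, Finset.eq_empty_iff_forall_notMem]
  exact fun e he => (hQ.1 e he).2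

theorem optimal_singleton (x : Fin k) {B : Set (Fin n)} {y : Fin n} (hy : y ∈ B) :
    Optimal σ τ {x} B [1] := by
  refine ⟨⟨[(1, x, y)], rfl, List.pairwise_singleton _ _, by simpa using hy⟩, fun Q hQ => ?_⟩
  refine Finset.card_le_one.2 fun e he f hf => (hQ.2 e he f hf).1 ?_
  exact (hQ.1 e he).1.trans (hQ.1 f hf).1.symm

end Common

/-! ### Concatenations -/

theorem length_rhoConcat {d : ℕ} (ρ : Equiv.Perm (Fin d)) (w : Fin d → List ℕ) :
    (rhoConcat ρ w).length = ∑ p, (w p).length := by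
  simp [rhoConcat, List.length_flatten, List.map_ofFn, List.sum_ofFn]

theorem oplus_eq_rhoConcat (w : Fin 2 → List ℕ) :
    oplus (w 0) (w 1) = rhoConcat (1 : Equiv.Perm (Fin 2)) w := by
  simp [oplus, rhoConcat, List.ofFn_succ, Finset.sum_filter, show Equiv.symm (1 : Equiv.Perm (Fin 2)) = 1 from rfl]

theorem ominus_eq_rhoConcat (w : Fin 2 → List ℕ) :
    ominus (w 0) (w 1) = rhoConcat (Equiv.swap (0 : Fin 2) 1) w := by
  simp [ominus, rhoConcat, List.ofFn_succ, Finset.sum_filter, Fin.sum_univ_two]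

/-- Block `p` takes its values in the interval from `off p + 1` to `off p + (w p).length`. These
intervals are disjoint, ordered as `ρ` orders the blocks, and contained in the range from 1 to the
total length. -/
theorem CommonIn.rhoConcat {k n d : ℕ} {σ : Equiv.Perm (Fin k)} {τ : Equiv.Perm (Fin n)}
    (ρ : Equiv.Perm (Fin d)) {J : Fin d → Set (Fin k)} {B : Fin d → Set (Fin n)}
    {w : Fin d → List ℕ} (hw : ∀ p, CommonIn σ τ (J p) (B p) (w p))
    (hJ : ∀ p q, p < q → Before (J p) (J q)) (hB : ∀ p q, p < q → Before (B p) (B q))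
    (hvJ : ∀ p q, ρ p < ρ q → ValuesBelow σ (J p) (J q))
    (hvB : ∀ p q, ρ p < ρ q → ValuesBelow τ (B p) (B q)) :
    CommonIn σ τ (⋃ p, J p) (⋃ p, B p) (rhoConcat ρ w) := by
  choose L hLw hL hmem using hw
  have hlen : ∀ p, (w p).length = (L p).length := fun p => by rw [← hLw p, List.length_map]
  set off : Fin d → ℕ := fun p =>
    ∑ v ∈ Finset.univ.filter (· < ρ p), (w (ρ.symm v)).length with hoff
  have hstep : ∀ p, off p + (w p).length =
      ∑ v ∈ Finset.univ.filter (· ≤ ρ p), (w (ρ.symm v)).length := by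
    intro p
    have : Finset.univ.filter (· ≤ ρ p) = insert (ρ p) (Finset.univ.filter (· < ρ p)) := by
      ext v
      simp [le_iff_eq_or_lt]
    rw [this, Finset.sum_insert (by simp), Equiv.symm_apply_apply, add_comm]
  have hoff_lt : ∀ p q, ρ p < ρ q → off p + (w p).length ≤ off q := by
    intro p q hpq
    rw [hstep]
    refine Finset.sum_le_sum_of_subset fun v hv => ?_
    simp only [Finset.mem_filter, Finset.mem_univ, true_and] at hv ⊢
    exact hv.trans_lt hpq
  have hoff_le : ∀ p, off p + (w p).length ≤ ∑ q, (w q).length := by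
    intro p
    rw [hstep, ← Equiv.sum_comp ρ.symm fun q => (w q).length]
    exact Finset.sum_le_sum_of_subset (Finset.filter_subset _ _)
  let sh : (p : Fin d) → ℕ × Fin k × Fin n → ℕ × Fin k × Fin n := fun p x => (x.1 + off p, x.2)
  refine ⟨(List.ofFn fun p => (L p).map (sh p)).flatten, ?_, ?_, ?_⟩
  · rw [List.map_flatten, List.map_ofFn, LCP.rhoConcat]
    congr 1
    congr 1
    funext p
    simp only [Function.comp_apply, List.map_map, ← hLw p]
    rfl
  · rw [List.pairwise_flatten]
    refine ⟨?_, ?_⟩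
    · intro l hl
      obtain ⟨p, rfl⟩ := (List.mem_ofFn' _ _).1 hl
      refine List.Pairwise.map _ (fun x y hxy => ?_) (hL p)
      obtain ⟨h1, h2, h3⟩ := hxy
      refine ⟨h1, h2, ?_⟩
      simp only [sh, add_lt_add_iff_right]
      exact h3
    · rw [List.pairwise_ofFn]
      intro p q hpq x hx y hy
      obtain ⟨x, hx', rfl⟩ := List.mem_map.1 hx
      obtain ⟨y, hy', rfl⟩ := List.mem_map.1 hy
      have hxm := hmem p x hx'
      have hym := hmem q y hy'
      refine ⟨hJ p q hpq _ hxm.2.2.1 _ hym.2.2.1, hB p q hpq _ hxm.2.2.2 _ hym.2.2.2, ?_⟩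
      rw [← hlen] at hxm hym
      rcases lt_or_gt_of_ne (ρ.injective.ne hpq.ne) with h | h
      · refine Or.inl ⟨?_, hvJ p q h _ hxm.2.2.1 _ hym.2.2.1, hvB p q h _ hxm.2.2.2 _ hym.2.2.2⟩
        have := hoff_lt p q h
        simp only [sh]
        omega
      · refine Or.inr ⟨?_, hvJ q p h _ hym.2.2.1 _ hxm.2.2.1, hvB q p h _ hym.2.2.2 _ hxm.2.2.2⟩
        have := hoff_lt q p h
        simp only [sh]
        omega
  · intro x hx
    obtain ⟨l, hl, hx⟩ := List.mem_flatten.1 hx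
    obtain ⟨p, rfl⟩ := (List.mem_ofFn' _ _).1 hl
    obtain ⟨x, hx', rfl⟩ := List.mem_map.1 hx
    have hxm := hmem p x hx'
    have htot : (List.ofFn fun p => (L p).map (sh p)).flatten.length = ∑ q, (w q).length := by
      simp [List.length_flatten, List.map_ofFn, List.sum_ofFn, hlen]
    have := hoff_le p
    rw [← hlen] at hxm
    refine ⟨?_, ?_, Set.mem_iUnion.2 ⟨p, hxm.2.2.1⟩, Set.mem_iUnion.2 ⟨p, hxm.2.2.2⟩⟩
    · simp only [sh]
      omega
    · rw [htot]
      simp only [sh]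
      omega

/-! ### Slicings -/

theorem mem_slicings {d lo hi : ℕ} {h : Fin (d + 1) → ℕ} (hh : h ∈ slicings d lo hi) :
    Monotone h ∧ h 0 = lo ∧ h (Fin.last d) = hi := by
  obtain ⟨-, h0, h1, h2⟩ := Finset.mem_filter.1 hh
  exact ⟨Fin.monotone_iff_le_succ.2 h2, h0, h1⟩

theorem le_of_mem_slicings {d lo hi : ℕ} {h : Fin (d + 1) → ℕ} (hh : h ∈ slicings d lo hi)
    (p : Fin (d + 1)) : lo ≤ h p ∧ h p ≤ hi := by
  obtain ⟨hm, rfl, rfl⟩ := mem_slicings hh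
  exact ⟨hm (Fin.zero_le p), hm (Fin.le_last p)⟩

theorem mem_slicings_of_monotone {d lo hi : ℕ} {h : Fin (d + 1) → ℕ} (hm : Monotone h)
    (h0 : h 0 = lo) (h1 : h (Fin.last d) = hi) : h ∈ slicings d lo hi := by
  subst h0 h1
  refine Finset.mem_filter.2 ⟨Fintype.mem_piFinset.2 fun p => Finset.mem_Icc.2
    ⟨hm (Fin.zero_le p), hm (Fin.le_last p)⟩, rfl, rfl, fun p => hm (Fin.castSucc_le_succ p)⟩

/-- Points sorted into consecutive blocks are separated by some slicing. -/
theorem exists_slicing {α : Type*} {d lo hi : ℕ} (hd : 0 < d) (hlh : lo ≤ hi) (Q : Finset α)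
    (blk : α → Fin d) (pos : α → ℕ) (hpos : ∀ e ∈ Q, lo ≤ pos e ∧ pos e < hi)
    (hmono : ∀ e ∈ Q, ∀ f ∈ Q, blk e < blk f → pos e < pos f) :
    ∃ h ∈ slicings d lo hi,
      ∀ e ∈ Q, h (blk e).castSucc ≤ pos e ∧ pos e + 1 ≤ h (blk e).succ := by
  classical
  -- Cut number `p` comes just after the last point of the blocks before `p`. The final cut is
  -- replaced by `hi`, which `g` need not reach.
  let g : ℕ → ℕ := fun p => max lo ((Q.filter fun e => (blk e : ℕ) < p).sup fun e => pos e + 1)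
  let h : Fin (d + 1) → ℕ := fun p => if p = Fin.last d then hi else g p
  have hg : Monotone g := fun p q hpq => max_le_max le_rfl (Finset.sup_mono fun e he => by
    simp only [Finset.mem_filter] at he ⊢
    exact ⟨he.1, he.2.trans_le hpq⟩)
  have hghi : ∀ p, g p ≤ hi := fun p => max_le hlh (Finset.sup_le fun e he =>
    (hpos e (Finset.mem_filter.1 he).1).2)
  have hgh : ∀ p : Fin (d + 1), g p ≤ h p := by
    intro p
    simp only [h]
    split_ifs
    · exact hghi _
    · exact le_rfl
  refine ⟨h, mem_slicings_of_monotone ?_ ?_ ?_, fun e he => ⟨?_, ?_⟩⟩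
  · intro p q hpq
    by_cases hq : q = Fin.last d
    · simp only [h, hq, if_true]
      split_ifs
      · exact le_rfl
      · exact hghi _
    · have hp : p ≠ Fin.last d := by
        rintro rfl
        exact hq (le_antisymm (Fin.le_last q) hpq)
      simp only [h, hq, hp, if_false]
      exact hg hpq
  · have : (0 : Fin (d + 1)) ≠ Fin.last d := by
      rw [Ne, Fin.ext_iff]
      simpa using hd.ne
    simp [h, this, g]
  · simp [h]
  · simp only [h, (Fin.castSucc_lt_last _).ne, if_false]
    refine max_le (hpos e he).1 (Finset.sup_le fun f hf => ?_)
    obtain ⟨hf, hfe⟩ := Finset.mem_filter.1 hf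
    exact hmono f hf e he hfe
  · refine le_trans ?_ (hgh _)
    refine le_max_of_le_right (Finset.le_sup (f := fun e => pos e + 1) ?_)
    simp [he]

/-! ### One step of the recursion -/

section Step

variable {k n d : ℕ} {σ : Equiv.Perm (Fin k)} {τ : Equiv.Perm (Fin n)} {ρ : Equiv.Perm (Fin d)}
  {J : Fin d → Set (Fin k)} {F : Fin d → ℕ → ℕ → ℕ → ℕ → List ℕ} {i j a b : ℕ}

/-- The `ρ`-concatenation of the entries of `F` that are determined by two slicings. -/
def sliceConcat (ρ : Equiv.Perm (Fin d)) (F : Fin d → ℕ → ℕ → ℕ → ℕ → List ℕ)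
    (h c : Fin (d + 1) → ℕ) : List ℕ :=
  rhoConcat ρ fun p =>
    F p (h p.castSucc) (h p.succ - 1) (c (ρ p).castSucc) (c (ρ p).succ - 1)

theorem CommonIn.mono {I I' : Set (Fin k)} {B B' : Set (Fin n)} {w : List ℕ}
    (h : CommonIn σ τ I B w) (hI : I ⊆ I') (hB : B ⊆ B') : CommonIn σ τ I' B' w := by
  obtain ⟨L, h1, h2, h3⟩ := h
  exact ⟨L, h1, h2, fun x hx => ⟨(h3 x hx).1, (h3 x hx).2.1, hI (h3 x hx).2.2.1,
    hB (h3 x hx).2.2.2⟩⟩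

/-- Monotone cuts make the sub-boxes separated in position by index and in value by `ρ`. All cuts
are at least 1, so the subtractions do not truncate. -/
theorem commonIn_sliceConcat (hJ : ∀ p q, p < q → Before (J p) (J q))
    (hv : ∀ p q, ρ p < ρ q → ValuesBelow σ (J p) (J q))
    (hF : ∀ p i j a b, 1 ≤ i → j ≤ n → 1 ≤ a → b ≤ n →
      CommonIn σ τ (J p) (box τ i j a b) (F p i j a b))
    (hi : 1 ≤ i) (hj : j ≤ n) (ha : 1 ≤ a) (hb : b ≤ n) {h c : Fin (d + 1) → ℕ}
    (hh : h ∈ slicings d i (j + 1)) (hc : c ∈ slicings d a (b + 1)) :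
    CommonIn σ τ (⋃ p, J p) (box τ i j a b) (sliceConcat ρ F h c) := by
  have hle := le_of_mem_slicings hh
  have cle := le_of_mem_slicings hc
  have hm := (mem_slicings hh).1
  have cm := (mem_slicings hc).1
  refine CommonIn.mono (CommonIn.rhoConcat ρ (B := fun p => box τ (h p.castSucc) (h p.succ - 1)
    (c (ρ p).castSucc) (c (ρ p).succ - 1)) (fun p => ?_) hJ ?_ hv ?_) subset_rfl ?_
  · have h1 := hle p.castSucc
    have h2 := hle p.succ
    have h3 := cle (ρ p).castSucc
    have h4 := cle (ρ p).succ
    exact hF p _ _ _ _ (by omega) (by omega) (by omega) (by omega)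
  · intro p q hpq x hx y hy
    have h1 : h p.succ ≤ h q.castSucc := hm (Fin.succ_le_castSucc_iff.2 hpq)
    have h2 := hle p.succ
    have h3 := hx.2.1
    have h4 := hy.1
    rw [Fin.lt_def]
    omega
  · intro p q hpq x hx y hy
    have h1 : c (ρ p).succ ≤ c (ρ q).castSucc := cm (Fin.succ_le_castSucc_iff.2 hpq)
    have h2 := cle (ρ p).succ
    have h3 := hx.2.2.2
    have h4 := hy.2.2.1
    rw [Fin.lt_def]
    omega
  · refine Set.iUnion_subset fun p x hx => ?_
    obtain ⟨x1, x2, x3, x4⟩ := hx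
    have h1 := hle p.castSucc
    have h2 := hle p.succ
    have h3 := cle (ρ p).castSucc
    have h4 := cle (ρ p).succ
    exact ⟨by omega, by omega, by omega, by omega⟩

theorem exists_card_le_length_sliceConcat (hd : 0 < d) (hJ : ∀ p q, p < q → Before (J p) (J q))
    (hv : ∀ p q, ρ p < ρ q → ValuesBelow σ (J p) (J q))
    (hF : ∀ p i j a b, 1 ≤ i → j ≤ n → 1 ≤ a → b ≤ n →
      ∀ Q, Matching σ τ (J p) (box τ i j a b) Q → Q.card ≤ (F p i j a b).length)
    (hi : 1 ≤ i) (hij : i ≤ j) (hj : j ≤ n) (ha : 1 ≤ a) (hab : a ≤ b) (hb : b ≤ n)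
    {Q : Finset (Fin k × Fin n)} (hQ : Matching σ τ (⋃ p, J p) (box τ i j a b) Q) :
    ∃ h ∈ slicings d i (j + 1), ∃ c ∈ slicings d a (b + 1),
      Q.card ≤ (sliceConcat ρ F h c).length := by
  classical
  have hex : ∀ e : Fin k × Fin n, ∃ p : Fin d, e ∈ Q → e.1 ∈ J p := by
    intro e
    by_cases he : e ∈ Q
    · obtain ⟨p, hp⟩ := Set.mem_iUnion.1 (hQ.1 e he).1
      exact ⟨p, fun _ => hp⟩
    -- The block assigned to a pair outside `Q` is arbitrary.
    · exact ⟨⟨0, hd⟩, fun h => absurd h he⟩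
  choose blk hblk using hex
  obtain ⟨h, hh, hhQ⟩ := exists_slicing hd (by omega : i ≤ j + 1) Q blk
    (fun e => (e.2 : ℕ) + 1) (fun e he => ⟨(hQ.1 e he).2.1, Nat.lt_succ_of_le (hQ.1 e he).2.2.1⟩)
    (fun e he f hf hef => Nat.succ_lt_succ
      ((hQ.2 e he f hf).2.1 (hJ _ _ hef _ (hblk e he) _ (hblk f hf))))
  obtain ⟨c, hc, hcQ⟩ := exists_slicing hd (by omega : a ≤ b + 1) Q (fun e => ρ (blk e))
    (fun e => (τ e.2 : ℕ) + 1)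
    (fun e he => ⟨(hQ.1 e he).2.2.2.1, Nat.lt_succ_of_le (hQ.1 e he).2.2.2.2⟩)
    (fun e he f hf hef => Nat.succ_lt_succ
      ((hQ.2 e he f hf).2.2 (hv _ _ hef _ (hblk e he) _ (hblk f hf))))
  refine ⟨h, hh, c, hc, ?_⟩
  have hle := le_of_mem_slicings hh
  have cle := le_of_mem_slicings hc
  -- The matching is counted block by block; each part is a matching inside the sub-box of its
  -- block.
  rw [sliceConcat, length_rhoConcat,
    Finset.card_eq_sum_card_fiberwise (f := blk) (t := Finset.univ) (fun _ _ => Finset.mem_univ _)]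
  refine Finset.sum_le_sum fun p _ => ?_
  have h1 := hle p.castSucc
  have h2 := hle p.succ
  have h3 := cle (ρ p).castSucc
  have h4 := cle (ρ p).succ
  refine hF p _ _ _ _ (by omega) (by omega) (by omega) (by omega) _ ⟨fun e he => ?_,
    fun e he f hf => hQ.2 e (Finset.mem_filter.1 he).1 f (Finset.mem_filter.1 hf).1⟩
  obtain ⟨heQ, rfl⟩ := Finset.mem_filter.1 he
  have h5 := hhQ e heQ
  have h6 := hcQ e heQ
  exact ⟨hblk e heQ, by omega, by omega, by omega, by omega⟩

theorem optimal_longest {longest : Finset (List ℕ) → List ℕ} (hl : IsLongestRule longest)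
    (hd : 0 < d) (hJ : ∀ p q, p < q → Before (J p) (J q))
    (hv : ∀ p q, ρ p < ρ q → ValuesBelow σ (J p) (J q))
    (hF : ∀ p i j a b, 1 ≤ i → j ≤ n → 1 ≤ a → b ≤ n →
      Optimal σ τ (J p) (box τ i j a b) (F p i j a b))
    (hi : 1 ≤ i) (hij : i ≤ j) (hj : j ≤ n) (ha : 1 ≤ a) (hab : a ≤ b) (hb : b ≤ n)
    {S : Finset (List ℕ)} (hS : ∀ w, w ∈ S ↔ ∃ h ∈ slicings d i (j + 1),
      ∃ c ∈ slicings d a (b + 1), w = sliceConcat ρ F h c) :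
    Optimal σ τ (⋃ p, J p) (box τ i j a b) (longest S) := by
  have hex := fun Q => exists_card_le_length_sliceConcat (ρ := ρ) (Q := Q) hd hJ hv
    (fun p i j a b h1 h2 h3 h4 => (hF p i j a b h1 h2 h3 h4).2) hi hij hj ha hab hb
  have hne : S.Nonempty := by
    -- The empty matching already provides a pair of slicings.
    obtain ⟨h, hh, c, hc, -⟩ := hex ∅ ⟨by simp, by simp⟩
    exact ⟨_, (hS _).2 ⟨h, hh, c, hc, rfl⟩⟩
  obtain ⟨hmem, hmax⟩ := hl S hne
  refine ⟨?_, fun Q hQ => ?_⟩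
  · obtain ⟨h, hh, c, hc, hw⟩ := (hS _).1 hmem
    rw [hw]
    exact commonIn_sliceConcat hJ hv
      (fun p i j a b h1 h2 h3 h4 => (hF p i j a b h1 h2 h3 h4).1) hi hj ha hb hh hc
  · obtain ⟨h, hh, c, hc, hw⟩ := hex Q hQ
    exact hw.trans (hmax _ ((hS _).2 ⟨h, hh, c, hc, rfl⟩))

end Step

theorem mem_slicings_two {lo hi : ℕ} {h : Fin 3 → ℕ} :
    h ∈ slicings 2 lo hi ↔ ∃ x ∈ Finset.Icc lo hi, h = ![lo, x, hi] := by
  constructor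
  · intro hh
    obtain ⟨-, h0, h2⟩ := mem_slicings hh
    refine ⟨h 1, Finset.mem_Icc.2 (le_of_mem_slicings hh 1), ?_⟩
    funext p
    fin_cases p
    · exact h0
    · rfl
    · exact h2
  · rintro ⟨x, hx, rfl⟩
    rw [Finset.mem_Icc] at hx
    refine mem_slicings_of_monotone (Fin.monotone_iff_le_succ.2 fun p => ?_) rfl rfl
    fin_cases p
    · exact hx.1
    · exact hx.2

theorem exists_mem_slicings_two {d e f g : ℕ} {P : (Fin 3 → ℕ) → (Fin 3 → ℕ) → Prop} :
    (∃ h ∈ slicings 2 d e, ∃ c ∈ slicings 2 f g, P h c) ↔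
      ∃ x ∈ Finset.Icc d e, ∃ y ∈ Finset.Icc f g, P ![d, x, e] ![f, y, g] := by
  constructor
  · rintro ⟨h, hh, c, hc, hP⟩
    obtain ⟨x, hx, rfl⟩ := mem_slicings_two.1 hh
    obtain ⟨y, hy, rfl⟩ := mem_slicings_two.1 hc
    exact ⟨x, hx, y, hy, hP⟩
  · rintro ⟨x, hx, y, hy, h⟩
    exact ⟨_, mem_slicings_two.2 ⟨x, hx, rfl⟩, _, mem_slicings_two.2 ⟨y, hy, rfl⟩, h⟩

/-! ### The contents of the table -/

/-- Only cells with nonempty intervals of indices in `{1, …, n}` are used. -/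
def Blank (n : ℕ) (M : Table) : Prop :=
  ∀ V i j a b, ¬ ((1 ≤ i ∧ i ≤ j ∧ j ≤ n) ∧ (1 ≤ a ∧ a ≤ b ∧ b ≤ n)) → M V i j a b = []

theorem Blank.assign {n : ℕ} {M : Table} (hM : Blank n M) (V : List ℕ)
    (f : ℕ → ℕ → ℕ → ℕ → List ℕ) : Blank n (assign n M V f) := by
  intro W i j a b h
  rw [LCP.assign, if_neg fun h' => h h'.2, hM W i j a b h]

theorem Blank.fillLeaf {n : ℕ} {τ : Equiv.Perm (Fin n)} {M : Table} (hM : Blank n M)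
    (x : List ℕ × DTree) : Blank n (fillLeaf τ M x) := by
  obtain ⟨V, t⟩ := x
  cases t
  · exact hM.assign _ _
  all_goals exact hM

theorem Blank.fillInternal {n : ℕ} {longest : Finset (List ℕ) → List ℕ} {M : Table}
    (hM : Blank n M) (x : List ℕ × DTree) : Blank n (fillInternal n longest M x) := by
  obtain ⟨V, t⟩ := x
  cases t
  · exact hM
  all_goals exact hM.assign _ _

theorem Blank.foldl_fillInternal {n : ℕ} {longest : Finset (List ℕ) → List ℕ} {M : Table}
    (hM : Blank n M) (ns : List (List ℕ × DTree)) :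
    Blank n (ns.foldl (LCP.fillInternal n longest) M) := by
  induction ns generalizing M with
  | nil => exact hM
  | cons x ns ih => exact ih (hM.fillInternal x)

theorem fillInternal_apply_of_ne {n : ℕ} {longest : Finset (List ℕ) → List ℕ} {M : Table}
    {x : List ℕ × DTree} {W : List ℕ} (h : W ≠ x.1) : fillInternal n longest M x W = M W := by
  obtain ⟨V, t⟩ := x
  have h' : W ≠ V := h
  funext i j a b
  cases t
  · rfl
  all_goals simp [fillInternal, assign, h']

theorem foldl_fillInternal_apply {n : ℕ} {longest : Finset (List ℕ) → List ℕ} {M : Table}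
    {ns : List (List ℕ × DTree)} {W : List ℕ} (h : ∀ x ∈ ns, W ≠ x.1) :
    ns.foldl (fillInternal n longest) M W = M W := by
  induction ns generalizing M with
  | nil => rfl
  | cons x ns ih =>
    rw [List.foldl_cons, ih fun y hy => h y (List.mem_cons_of_mem _ hy),
      fillInternal_apply_of_ne (h x List.mem_cons_self)]

theorem suffix_of_mem_postfixNodes {T : DTree} {V : List ℕ} {x : List ℕ × DTree}
    (hx : x ∈ T.postfixNodes V) : V <:+ x.1 := by
  induction T generalizing V with
  | leaf =>
    simp only [DTree.postfixNodes, List.mem_singleton] at hx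
    subst hx
    exact List.suffix_refl _
  | pos l r ihl ihr | neg l r ihl ihr =>
    simp only [DTree.postfixNodes, List.mem_append, List.mem_singleton] at hx
    rcases hx with (hx | hx) | rfl
    · exact (List.suffix_cons _ _).trans (ihl hx)
    · exact (List.suffix_cons _ _).trans (ihr hx)
    · exact List.suffix_refl _
  | prime d ρ c ih =>
    simp only [DTree.postfixNodes, List.mem_append, List.mem_flatMap, List.mem_singleton] at hx
    rcases hx with ⟨p, -, hx⟩ | rfl
    · exact (List.suffix_cons _ _).trans (ih p hx)
    · exact List.suffix_refl _

/-- Addresses are read towards the root, so descendants of a node have its address as a suffix.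
Hence subtrees of different children share no address. -/
theorem eq_of_cons_suffix {α : Type*} {p q : α} {V W : List α} (hp : p :: V <:+ W)
    (hq : q :: V <:+ W) : p = q := by
  have h := List.IsSuffix.eq_of_length (List.suffix_of_suffix_length_le hp hq (by simp)) (by simp)
  exact (List.cons.inj h).1

/-! ### The leaf phase -/

/-- The value that a leaf has to get in a cell. -/
noncomputable def leafValue {n : ℕ} (τ : Equiv.Perm (Fin n)) (i j a b : ℕ) : List ℕ :=
  open Classical in if (box τ i j a b).Nonempty then [1] else []

theorem optimal_leafValue {k n : ℕ} (σ : Equiv.Perm (Fin k)) (τ : Equiv.Perm (Fin n)) (x : Fin k)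
    (i j a b : ℕ) : Optimal σ τ {x} (box τ i j a b) (leafValue τ i j a b) := by
  unfold leafValue
  split_ifs with h
  · exact optimal_singleton x h.some_mem
  · exact optimal_nil (Set.not_nonempty_iff_eq_empty.1 h)

/-- At the address `V`, the table contains the values of a leaf. -/
def LeafAt {n : ℕ} (τ : Equiv.Perm (Fin n)) (M : Table) (V : List ℕ) : Prop :=
  ∀ i j a b, 1 ≤ i → j ≤ n → 1 ≤ a → b ≤ n → M V i j a b = leafValue τ i j a b

theorem fillLeaf_apply {n : ℕ} {τ : Equiv.Perm (Fin n)} {M : Table} {x : List ℕ × DTree}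
    {W : List ℕ} {i j a b : ℕ} (h : M W i j a b = leafValue τ i j a b) :
    fillLeaf τ M x W i j a b = leafValue τ i j a b := by
  obtain ⟨V, t⟩ := x
  cases t
  · simp only [fillLeaf, assign]
    split_ifs with h1 h2
    · exact (if_pos h2).symm
    · rw [← h1.1, h]
    · exact h
  all_goals exact h

/-- A leaf cell whose test fails keeps its old content. This invariant ensures that the content is
then `[]`, the value of an empty box. -/
theorem fillLeaf_eq_nil_or {n : ℕ} {τ : Equiv.Perm (Fin n)} {M : Table} {x : List ℕ × DTree}
    (h : ∀ W i j a b, M W i j a b = [] ∨ M W i j a b = leafValue τ i j a b) (W : List ℕ)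
    (i j a b : ℕ) : fillLeaf τ M x W i j a b = [] ∨
      fillLeaf τ M x W i j a b = leafValue τ i j a b := by
  obtain ⟨V, t⟩ := x
  cases t
  · simp only [fillLeaf, assign]
    split_ifs with h1 h2
    · exact Or.inr (if_pos h2).symm
    · exact h _ _ _ _ _
    · exact h _ _ _ _ _
  all_goals exact h _ _ _ _ _

theorem leafAt_fillLeaf {n : ℕ} {τ : Equiv.Perm (Fin n)} {M : Table} {V : List ℕ}
    (hM : Blank n M) (h : ∀ W i j a b, M W i j a b = [] ∨ M W i j a b = leafValue τ i j a b) :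
    LeafAt τ (fillLeaf τ M (V, .leaf)) V := by
  intro i j a b hi hj ha hb
  simp only [fillLeaf, assign]
  split_ifs with h1 h2
  · exact (if_pos h2).symm
  · rcases h V i j a b with h' | h'
    · rw [h']
      exact (if_neg h2).symm
    · exact h'
  · rw [hM _ _ _ _ _ fun h' => h1 ⟨trivial, h'⟩]
    refine (if_neg ?_).symm
    rintro ⟨x, h2, h3, h4, h5⟩
    exact h1 ⟨trivial, ⟨hi, by omega, hj⟩, ha, by omega, hb⟩

theorem leafAt_foldl_fillLeaf {n : ℕ} {τ : Equiv.Perm (Fin n)} {M : Table} (hM : Blank n M)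
    (h : ∀ W i j a b, M W i j a b = [] ∨ M W i j a b = leafValue τ i j a b)
    (ns : List (List ℕ × DTree)) :
    Blank n (ns.foldl (fillLeaf τ) M) ∧
      ∀ V, ((V, DTree.leaf) ∈ ns ∨ LeafAt τ M V) → LeafAt τ (ns.foldl (fillLeaf τ) M) V := by
  induction ns generalizing M with
  | nil => exact ⟨hM, fun V hV => by simpa using hV⟩
  | cons x ns ih =>
    obtain ⟨h1, h2⟩ := ih (hM.fillLeaf (τ := τ) x) (fillLeaf_eq_nil_or h)
    refine ⟨h1, fun V hV => h2 V ?_⟩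
    rw [List.mem_cons] at hV
    rcases hV with (rfl | hV) | hV
    · exact Or.inr (leafAt_fillLeaf hM h)
    · exact Or.inl hV
    · exact Or.inr fun i j a b hi hj ha hb => fillLeaf_apply (hV i j a b hi hj ha hb)

/-! ### The internal phase -/

section Internal

variable {k n : ℕ} (σ : Equiv.Perm (Fin k)) (τ : Equiv.Perm (Fin n))
  (longest : Finset (List ℕ) → List ℕ)

/-- The cells at the address `V` contain longest common patterns of `σ` restricted to `I` and the
respective parts of `τ`. -/
def OptimalAt (I : Set (Fin k)) (M : Table) (V : List ℕ) : Prop :=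
  ∀ i j a b, 1 ≤ i → j ≤ n → 1 ≤ a → b ≤ n → Optimal σ τ I (box τ i j a b) (M V i j a b)

/-- Processing the nodes of `T` makes the cells at its root optimal. -/
def Computes (T : DTree) (I : Set (Fin k)) : Prop :=
  ∀ V M, Blank n M → (∀ W, (W, DTree.leaf) ∈ T.postfixNodes V → LeafAt τ M W) →
    OptimalAt σ τ I ((T.postfixNodes V).foldl (fillInternal n longest) M) V

variable {σ τ longest}

/-- Optimality is also needed for empty intervals, which arise when two consecutive cuts coincide.
Such cells are never assigned; they hold `[]`, which is optimal for an empty box. -/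
theorem OptimalAt.assign {I : Set (Fin k)} {M : Table} {V : List ℕ}
    {f : ℕ → ℕ → ℕ → ℕ → List ℕ} (hM : Blank n M)
    (hf : ∀ i j a b, 1 ≤ i → i ≤ j → j ≤ n → 1 ≤ a → a ≤ b → b ≤ n →
      Optimal σ τ I (box τ i j a b) (f i j a b)) :
    OptimalAt σ τ I (assign n M V f) V := by
  intro i j a b hi hj ha hb
  rw [LCP.assign]
  split_ifs with h
  · exact hf i j a b hi h.2.1.2.1 hj ha h.2.2.2.1 hb
  · rw [hM _ _ _ _ _ fun h' => h ⟨rfl, h'⟩]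
    refine optimal_nil (Set.eq_empty_of_forall_notMem ?_)
    rintro x ⟨h2, h3, h4, h5⟩
    exact h ⟨rfl, ⟨hi, by omega, hj⟩, ha, by omega, hb⟩

/-- Processing one child's subtree changes neither the finished cells of earlier siblings nor the
leaves of later ones, because the addresses are disjoint. -/
theorem optimalAt_foldl_children {d : ℕ} {c : Fin d → DTree} {J : Fin d → Set (Fin k)}
    (hc : ∀ p, Computes σ τ longest (c p) (J p)) (V : List ℕ) (ps : List (Fin d)) (hps : ps.Nodup)
    (M : Table) (hM : Blank n M)
    (hleaf : ∀ p ∈ ps, ∀ W, (W, DTree.leaf) ∈ (c p).postfixNodes (p :: V) → LeafAt τ M W) :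
    ∀ p ∈ ps, OptimalAt σ τ (J p) ((ps.flatMap fun p => (c p).postfixNodes ((p : ℕ) :: V)).foldl
      (fillInternal n longest) M) (p :: V) := by
  induction ps generalizing M with
  | nil => simp
  | cons p ps ih =>
    obtain ⟨hp, hps⟩ := List.nodup_cons.1 hps
    have hdisj : ∀ q ∈ ps, ∀ W, (p : ℕ) :: V <:+ W → ¬ (q : ℕ) :: V <:+ W := by
      intro q hq W h1 h2
      exact hp (Fin.ext (eq_of_cons_suffix h1 h2) ▸ hq)
    rw [List.flatMap_cons, List.foldl_append]
    intro q hq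
    rcases List.mem_cons.1 hq with rfl | hq
    · intro i j a b
      rw [foldl_fillInternal_apply]
      · exact hc q _ _ hM (hleaf q List.mem_cons_self) i j a b
      · intro x hx hxq
        obtain ⟨r, hr, hx⟩ := List.mem_flatMap.1 hx
        exact hdisj r hr _ (hxq ▸ List.suffix_refl _) (suffix_of_mem_postfixNodes hx)
    · refine ih hps _ (hM.foldl_fillInternal _) (fun r hr W hW i j a b => ?_) q hq
      rw [foldl_fillInternal_apply]
      · exact hleaf r (List.mem_cons_of_mem _ hr) W hW i j a b
      · rintro x hx rfl
        exact hdisj r hr _ (suffix_of_mem_postfixNodes hx)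
          (suffix_of_mem_postfixNodes (x := (x.1, DTree.leaf)) hW)

theorem Decomposes.computes (hl : IsLongestRule longest) {T : DTree} {I : Set (Fin k)}
    (hT : Decomposes σ T I) : Computes σ τ longest T I := by
  -- Binary nodes are treated as nodes with two children labeled by the identity or the
  -- transposition, so that one recursion step serves all three kinds.
  have htwo : ∀ {l r : DTree} (V : List ℕ), l.postfixNodes (0 :: V) ++ r.postfixNodes (1 :: V) =
      (List.finRange 2).flatMap fun p => (![l, r] p).postfixNodes ((p : ℕ) :: V) := by
    intro l r V
    simp [List.finRange_succ]
  have hU : ∀ A B : Set (Fin k), A ∪ B = ⋃ p, ![A, B] p := by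
    intro A B
    ext x
    simp [Fin.exists_fin_two]
  have hJ : ∀ {A B : Set (Fin k)}, Before A B →
      ∀ p q : Fin 2, p < q → Before (![A, B] p) (![A, B] q) := by
    intro A B h p q hpq
    fin_cases p <;> fin_cases q <;> first | exact h | simp at hpq
  induction hT with
  | leaf x =>
    intro V M _ hleaf i j a b hi hj ha hb
    have := hleaf V (by simp [DTree.postfixNodes]) i j a b hi hj ha hb
    simp only [DTree.postfixNodes, List.foldl_cons, List.foldl_nil, fillInternal]
    rw [this]
    exact optimal_leafValue σ τ x i j a b
  | @pos l r A B _ _ hAB hv ihl ihr =>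
    intro V M hM hleaf
    have key := optimalAt_foldl_children (c := ![l, r]) (J := ![A, B])
      (fun p => by fin_cases p <;> assumption) V (List.finRange 2) (List.nodup_finRange _) M hM
      (fun p _ W hW => hleaf W (by
        rw [DTree.postfixNodes, htwo]
        exact List.mem_append_left _ (List.mem_flatMap.2 ⟨p, List.mem_finRange p, hW⟩)))
    rw [DTree.postfixNodes, htwo, List.foldl_append, hU]
    refine OptimalAt.assign (hM.foldl_fillInternal _) fun i j a b hi hij hj ha hab hb => ?_
    refine optimal_longest (ρ := 1) hl two_pos (hJ hAB) ?_
      (fun p => key p (List.mem_finRange p)) hi hij hj ha hab hb fun w => ?_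
    · intro p q hpq
      fin_cases p <;> fin_cases q <;> first | exact hv | simp at hpq
    · rw [exists_mem_slicings_two]
      simp only [Finset.mem_image, Finset.mem_product, Prod.exists, sliceConcat,
        ← oplus_eq_rhoConcat]
      constructor
      · rintro ⟨x, y, ⟨hx, hy⟩, rfl⟩
        exact ⟨x, hx, y, hy, rfl⟩
      · rintro ⟨x, hx, y, hy, rfl⟩
        exact ⟨x, y, ⟨hx, hy⟩, rfl⟩
  | @neg l r A B _ _ hAB hv ihl ihr =>
    intro V M hM hleaf
    have key := optimalAt_foldl_children (c := ![l, r]) (J := ![A, B])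
      (fun p => by fin_cases p <;> assumption) V (List.finRange 2) (List.nodup_finRange _) M hM
      (fun p _ W hW => hleaf W (by
        rw [DTree.postfixNodes, htwo]
        exact List.mem_append_left _ (List.mem_flatMap.2 ⟨p, List.mem_finRange p, hW⟩)))
    rw [DTree.postfixNodes, htwo, List.foldl_append, hU]
    refine OptimalAt.assign (hM.foldl_fillInternal _) fun i j a b hi hij hj ha hab hb => ?_
    refine optimal_longest (ρ := Equiv.swap 0 1) hl two_pos (hJ hAB) ?_
      (fun p => key p (List.mem_finRange p)) hi hij hj ha hab hb fun w => ?_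
    · intro p q hpq
      fin_cases p <;> fin_cases q <;> first | exact hv | simp at hpq
    · rw [exists_mem_slicings_two]
      simp only [Finset.mem_image, Finset.mem_product, Prod.exists, sliceConcat,
        ← ominus_eq_rhoConcat]
      constructor
      · rintro ⟨x, y, ⟨hx, hy⟩, rfl⟩
        exact ⟨x, hx, y, hy, rfl⟩
      · rintro ⟨x, hx, y, hy, rfl⟩
        exact ⟨x, y, ⟨hx, hy⟩, rfl⟩
  | @prime d ρ c J hd _ hJ hv ih =>
    intro V M hM hleaf
    have key := optimalAt_foldl_children ih V (List.finRange d) (List.nodup_finRange _) M hM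
      (fun p _ W hW => hleaf W (by
        rw [DTree.postfixNodes]
        exact List.mem_append_left _ (List.mem_flatMap.2 ⟨p, List.mem_finRange p, hW⟩)))
    rw [DTree.postfixNodes, List.foldl_append]
    refine OptimalAt.assign (hM.foldl_fillInternal _) fun i j a b hi hij hj ha hab hb => ?_
    refine optimal_longest (ρ := ρ) hl hd hJ hv
      (fun p => key p (List.mem_finRange p)) hi hij hj ha hab hb fun w => ?_
    simp only [Finset.mem_image, Finset.mem_product, Prod.exists, sliceConcat]
    constructor
    · rintro ⟨h, c, ⟨hh, hc⟩, rfl⟩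
      exact ⟨h, hh, c, hc, rfl⟩
    · rintro ⟨h, hh, c, hc, rfl⟩
      exact ⟨h, c, ⟨hh, hc⟩, rfl⟩

end Internal

end LCP

theorem mainTheorem4 {k n : ℕ} (σ : Equiv.Perm (Fin k)) (τ : Equiv.Perm (Fin n))
    (T : LCP.DTree) (hT : LCP.IsExpandedDecompositionTree T σ)
    (longest : Finset (List ℕ) → List ℕ) (hlongest : LCP.IsLongestRule longest) :
    LCP.IsLongestCommonPattern (LCP.algorithm longest T τ) σ τ := by
  obtain ⟨L, hL, rfl⟩ := hT
  have hblank : LCP.Blank n fun _ _ _ _ _ => [] := fun _ _ _ _ _ _ => rfl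
  obtain ⟨h1, h2⟩ := LCP.leafAt_foldl_fillLeaf (τ := τ) hblank
    (fun _ _ _ _ _ => Or.inl rfl) (L.expand.postfixNodes [])
  have h := (LCP.LabeledTree.Represents.decomposes L _ hL).computes (τ := τ) hlongest [] _ h1
    (fun W hW => h2 W (Or.inl hW)) 1 n 1 n le_rfl le_rfl le_rfl le_rfl
  -- The output cell imposes no restriction on `τ`, just as the root imposes none on `σ`.
  have hbox : LCP.box τ 1 n 1 n = Set.univ :=
    Set.eq_univ_of_forall fun x => ⟨by omega, by omega, by omega, by omega⟩
  rw [hbox] at h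
  exact h.isLongestCommonPattern
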